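/- All Banach spaces are real, and compact spaces are Hausdorff. For a set $I$, let $\Sigma(I)\subset\mathbb R^I$ be the set of functions with countable support, with the product topology; a compact space is a *Corson compactum* if it is homeomorphic to a closed subset of $\Sigma(I)$ for some set $I$. A Banach space $X$ has the *$c_0$-extension property* if every bounded linear operator $T\colon Y\to c_0$ defined on a closed subspace $Y$ of $X$ extends to a bounded linear operator $X\to c_0$. A compact space $K$ has *Property (M)* if every regular finite signed Borel measure $\mu$ on $K$ has separable support $\operatorname{supp}\mu=\{p\in K: |\mu|(U)>0 \text{ for every open neighborhood } U \text{ of } p\}$. A family $\mathcal A$ of subsets of a set $\Gamma$ is *adequate* if every subset of a member of $\mathcal A$ belongs to $\mathcal A$, and every $A\subset\Gamma$ all of whose finite subsets belong to $\mathcal A$ belongs to $\mathcal A$; a compact space is *defined by* $\mathcal A$ if it is homeomorphic to $\{\mathbf 1_A: A\in\mathcal A\}\subset\{0,1\}^\Gamma$. **Proposition.** Assume the Continuum Hypothesis. There exists a Corson compactum $K$, defined by an adequate family of sets and without Property (M), such that the space $C(K)$ of continuous real-valued functions on $K$ with the supremum norm contains an isomorphic copy of $\ell_1(\omega_1)$ and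 does not have the $c_0$-extension property. -/

import Mathlib

open scoped ZeroAtInfty Cardinal Ordinal

universe u

/-- `Σ(I)`: the real-valued functions on `I` with countable support, with the topology
inherited from the product topology of `ℝ^I`. -/
def SigmaProduct (I : Type*) : Set (I → ℝ) :=
  {x | (Function.support x).Countable}

/-- A Corson compactum: a compact space homeomorphic to a closed subset of some `Σ(I)`
(the Hausdorff property follows). -/
def IsCorsonCompactum (K : Type u) [TopologicalSpace K] : Prop :=
  CompactSpace K ∧
    ∃ (I : Type u) (F : Set (SigmaProduct I)), IsClosed F ∧ Nonempty (K ≃ₜ F)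

/-- The `c₀`-extension property of a real normed space `X`: every bounded operator from a closed
subspace of `X` to `c₀` extends to a bounded operator from `X` to `c₀`. Here `c₀` is the space
`C₀(ℕ, ℝ)` of real sequences converging to zero, with the supremum norm. -/
def HasC0ExtensionProperty (X : Type*) [NormedAddCommGroup X] [NormedSpace ℝ X] : Prop :=
  ∀ Y : Submodule ℝ X, IsClosed (Y : Set X) →
    ∀ T : Y →L[ℝ] C₀(ℕ, ℝ), ∃ S : X →L[ℝ] C₀(ℕ, ℝ), ∀ y : Y, S (y : X) = T y

/-- `X` contains an isomorphic copy of `E`: some linear subspace of `X` is linearly homeomorphic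
to `E`. -/
def ContainsIsomorphicCopy (X E : Type*) [NormedAddCommGroup X] [NormedSpace ℝ X]
    [NormedAddCommGroup E] [NormedSpace ℝ E] : Prop :=
  ∃ Y : Submodule ℝ X, Nonempty (E ≃L[ℝ] Y)

/-- The Banach space `ℓ₁(ω₁)` of absolutely summable real families indexed by the countable
ordinals. -/
abbrev EllOneOmegaOne : Type :=
  lp (fun _ : (ω₁ : Ordinal.{0}).ToType => ℝ) 1

/-- Property (M): every finite regular signed Borel measure on `K` has separable support. The
support is the support of the total variation. -/
def HasPropertyM (K : Type*) [TopologicalSpace K] : Prop :=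
  letI : MeasurableSpace K := borel K
  ∀ μ : MeasureTheory.SignedMeasure K, μ.totalVariation.Regular →
    TopologicalSpace.SeparableSpace μ.totalVariation.support

/-- A family `𝒜` of subsets of `Γ` is adequate: it is closed under subsets, and a set all of whose
finite subsets belong to `𝒜` belongs to `𝒜`. -/
def IsAdequateFamily {Γ : Type*} (𝒜 : Set (Set Γ)) : Prop :=
  (∀ A ∈ 𝒜, ∀ B ⊆ A, B ∈ 𝒜) ∧
    ∀ A : Set Γ, (∀ B ⊆ A, B.Finite → B ∈ 𝒜) → A ∈ 𝒜

/-- The space of characteristic functions of the members of `𝒜`, as a subset of `ℝ^Γ`. -/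
def adequateSpace {Γ : Type*} (𝒜 : Set (Set Γ)) : Set (Γ → ℝ) :=
  {x | ∃ A ∈ 𝒜, x = A.indicator 1}

/-- `K` is, up to homeomorphism, the space defined by an adequate family of sets. -/
def IsDefinedByAdequateFamily (K : Type u) [TopologicalSpace K] : Prop :=
  ∃ (Γ : Type u) (𝒜 : Set (Set Γ)), IsAdequateFamily 𝒜 ∧ Nonempty (K ≃ₜ adequateSpace 𝒜)

/-! Under CH, enumerate the unit interval in type `ω₁` and let `E γ` be a compact set of measure
more than 1/2 that misses all points of index below `γ`. Each point then lies in only countably many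
`E γ`. Sets of indices whose `E γ` share a point form an adequate family (by compactness) of
countable sets, so its space `K` is Corson. Integration against Lebesgue measure gives the rest.
Since every `E γ` has measure at least 1/2, the coordinate functions span a copy of `ℓ₁(ω₁)` in
`C(K)`, and the image of Lebesgue measure on `K` has nonseparable support. The `c₀`-extension
property passes to isomorphic copies of Banach spaces inside `X`, but `ℓ₁(𝔠)` lacks it: it maps onto
`ℓ∞`, and an almost disjoint family rules out an extension, as in the proof that `c₀` is not
complemented in `ℓ∞`. -/

open Filter Topology MeasureTheory

/-! ### Operators defined on `ℓ₁(Γ)` -/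

section EllOne

variable {Γ : Type*} {E : Type*} [NormedAddCommGroup E] [NormedSpace ℝ E]

theorem lp_one_hasSum_norm (a : lp (fun _ : Γ => ℝ) 1) : HasSum (fun γ => ‖a γ‖) ‖a‖ := by
  simpa using lp.hasSum_norm (p := 1) (by simp) a

theorem lp_one_summable_norm_smul (a : lp (fun _ : Γ => ℝ) 1) {f : Γ → E}
    (hf : ∀ γ, ‖f γ‖ ≤ 1) : Summable fun γ => ‖a γ • f γ‖ := by
  refine (lp_one_hasSum_norm a).summable.of_nonneg_of_le (fun _ => norm_nonneg _) fun γ => ?_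
  rw [norm_smul]
  exact mul_le_of_le_one_right (norm_nonneg _) (hf γ)

/-- The operator on `ℓ₁(Γ)` sending the unit vectors to a given family in the unit ball. -/
noncomputable def ellOneLift [CompleteSpace E] (f : Γ → E) (hf : ∀ γ, ‖f γ‖ ≤ 1) :
    lp (fun _ : Γ => ℝ) 1 →L[ℝ] E :=
  LinearMap.mkContinuous
    { toFun := fun a => ∑' γ, a γ • f γ
      map_add' := fun a b => by
        rw [← ((lp_one_summable_norm_smul a hf).of_norm).tsum_add
          ((lp_one_summable_norm_smul b hf).of_norm)]
        simp [add_smul]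
      map_smul' := fun c a => by
        simp only [RingHom.id_apply]
        rw [← ((lp_one_summable_norm_smul a hf).of_norm).tsum_const_smul]
        simp [mul_smul] } 1 (fun a => by
      rw [one_mul]
      refine tsum_of_norm_bounded (lp_one_hasSum_norm a) fun γ => ?_
      rw [norm_smul]
      exact mul_le_of_le_one_right (norm_nonneg _) (hf γ))

theorem ellOneLift_apply [CompleteSpace E] (f : Γ → E) (hf : ∀ γ, ‖f γ‖ ≤ 1)
    (a : lp (fun _ : Γ => ℝ) 1) : ellOneLift f hf a = ∑' γ, a γ • f γ := rfl

theorem ellOneLift_single [CompleteSpace E] [DecidableEq Γ] (f : Γ → E) (hf : ∀ γ, ‖f γ‖ ≤ 1)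
    (γ : Γ) : ellOneLift f hf (lp.single 1 γ 1) = f γ := by
  rw [ellOneLift_apply, tsum_eq_single γ]
  · simp
  · intro δ hδ
    simp [hδ]

end EllOne

/-! ### Isomorphic copies and inheritance of the extension property -/

section Subspace

variable {X E : Type*} [NormedAddCommGroup X] [NormedSpace ℝ X]
  [NormedAddCommGroup E] [NormedSpace ℝ E]

theorem ContainsIsomorphicCopy.of_bounded_below {i : E →L[ℝ] X} {C : ℝ}
    (hC : ∀ a, ‖a‖ ≤ C * ‖i a‖) : ContainsIsomorphicCopy X E := by
  have hinj : Function.Injective i := by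
    refine (injective_iff_map_eq_zero i).2 fun a ha => norm_le_zero_iff.1 ?_
    simpa [ha] using hC a
  refine ⟨LinearMap.range (i : E →ₗ[ℝ] X), ⟨(LinearEquiv.ofInjective (i : E →ₗ[ℝ] X)
    hinj).toContinuousLinearEquivOfBounds ‖i‖ C (fun a => ?_) fun y => ?_⟩⟩
  · exact i.le_opNorm a
  · obtain ⟨a, rfl⟩ := (LinearEquiv.ofInjective (i : E →ₗ[ℝ] X) hinj).surjective y
    rw [LinearEquiv.symm_apply_apply]
    exact hC a

theorem HasC0ExtensionProperty.of_containsIsomorphicCopy [CompleteSpace E]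
    (hX : HasC0ExtensionProperty X) (h : ContainsIsomorphicCopy X E) :
    HasC0ExtensionProperty E := by
  obtain ⟨Z, ⟨e⟩⟩ := h
  intro Y hY T
  have hemb : IsUniformEmbedding (fun a : E => (e a : X)) :=
    isUniformEmbedding_subtype_val.comp (e.toHomeomorph.toEquiv.isUniformEmbedding
      (e : E →L[ℝ] Z).uniformContinuous (e.symm : Z →L[ℝ] E).uniformContinuous)
  let W : Submodule ℝ X := Y.map (Z.subtypeL.comp (e : E →L[ℝ] Z) : E →ₗ[ℝ] X)
  have hmem : ∀ w : W, ∃ hw : (w : X) ∈ Z, e.symm ⟨w, hw⟩ ∈ Y := by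
    rintro ⟨_, y, hy, rfl⟩
    exact ⟨(e y).2, by simpa using hy⟩
  -- Completeness of `E` makes `Y` complete, and a uniform embedding preserves completeness.
  have hW : IsClosed (W : Set X) := by
    have : IsComplete ((fun a : E => (e a : X)) '' (Y : Set E)) :=
      (isComplete_image_iff hemb.isUniformInducing).2 hY.isComplete
    exact this.isClosed
  let r₁ : W →L[ℝ] Z := W.subtypeL.codRestrict Z fun w => (hmem w).1
  let r : W →L[ℝ] Y := ((e.symm : Z →L[ℝ] E).comp r₁).codRestrict Y fun w => (hmem w).2
  obtain ⟨S, hS⟩ := hX W hW (T.comp r)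
  refine ⟨S.comp (Z.subtypeL.comp (e : E →L[ℝ] Z)), fun y => ?_⟩
  have := hS ⟨e y, y, y.2, rfl⟩
  refine this.trans (congrArg T (Subtype.ext ?_))
  exact e.symm_apply_apply y

end Subspace

/-! ### An almost disjoint family indexed by the Cantor set -/

section AlmostDisjoint

/-- The set of codes of the finite initial segments of a binary sequence. -/
def branch (x : ℕ → Bool) : Set ℕ :=
  Set.range fun n => Encodable.encode ((List.range n).map x)

theorem branch_infinite (x : ℕ → Bool) : (branch x).Infinite := by
  refine Set.infinite_range_of_injective fun m n h => ?_
  simpa using congrArg List.length (Encodable.encode_injective h)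

theorem branch_inter_finite {x y : ℕ → Bool} (hxy : x ≠ y) : (branch x ∩ branch y).Finite := by
  obtain ⟨m, hm⟩ := Function.ne_iff.1 hxy
  refine ((Set.finite_Iic m).image fun n => Encodable.encode ((List.range n).map x)).subset ?_
  rintro _ ⟨⟨n, rfl⟩, ⟨k, hk⟩⟩
  refine ⟨n, ?_, rfl⟩
  have h := Encodable.encode_injective hk
  have hkn : k = n := by simpa using congrArg List.length h
  subst hkn
  by_contra hlt
  simp only [Set.mem_Iic, not_le] at hlt
  have := List.map_inj_left.1 h m (List.mem_range.2 hlt)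
  exact hm this.symm

end AlmostDisjoint

/-! ### Failure of the `c₀`-extension property for `ℓ₁(𝔠)` -/

section NoExtension

/-- The vectors mapped by `q` to null sequences. -/
def nullPreimage {X : Type*} [NormedAddCommGroup X] [NormedSpace ℝ X]
    (q : X →L[ℝ] BoundedContinuousFunction ℕ ℝ) : Submodule ℝ X where
  carrier := {a | Tendsto (q a) (cocompact ℕ) (𝓝 0)}
  add_mem' {a b} ha hb := by
    have := Tendsto.add ha hb
    simpa [Pi.add_def] using this
  zero_mem' := by
    rw [Set.mem_ofPred_eq, map_zero]
    exact tendsto_const_nhds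
  smul_mem' c a ha := by
    have := Tendsto.const_mul c ha
    simpa [Pi.smul_def] using this

theorem isClosed_nullPreimage {X : Type*} [NormedAddCommGroup X] [NormedSpace ℝ X]
    (q : X →L[ℝ] BoundedContinuousFunction ℕ ℝ) : IsClosed (nullPreimage q : Set X) := by
  have h := (ZeroAtInftyContinuousMap.isClosed_range_toBCF (α := ℕ) (β := ℝ)).preimage q.continuous
  convert! h using 1
  ext a
  constructor
  · intro ha
    exact ⟨⟨(q a).toContinuousMap, ha⟩, by ext; rfl⟩
  · rintro ⟨g, hg⟩
    change Tendsto (q a) _ _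
    rw [← hg]
    exact g.zero_at_infty'

/-- The restriction of `q` to the preimage of the null sequences, as an operator into `c₀`. -/
noncomputable def nullRestrict {X : Type*} [NormedAddCommGroup X] [NormedSpace ℝ X]
    (q : X →L[ℝ] BoundedContinuousFunction ℕ ℝ) : nullPreimage q →L[ℝ] C₀(ℕ, ℝ) :=
  LinearMap.mkContinuous
    { toFun := fun y => ⟨(q y).toContinuousMap, y.2⟩
      map_add' := fun y z => by ext n; exact congrArg (fun g => g n) (map_add q (y : X) z)
      map_smul' := fun c y => by ext n; exact congrArg (fun g => g n) (map_smul q c (y : X)) }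
    ‖q‖ (fun y => by
      rw [← ZeroAtInftyContinuousMap.norm_toBCF_eq_norm]
      exact q.le_opNorm y)

/-- If the unit ball of `X` is mapped onto the unit ball of `ℓ∞`, then the resulting operator from
the preimage of `c₀` to `c₀` does not extend to `X`. -/
theorem not_hasC0ExtensionProperty_of_lift {X : Type*} [NormedAddCommGroup X] [NormedSpace ℝ X]
    (q : X →L[ℝ] BoundedContinuousFunction ℕ ℝ)
    (hq : ∀ g : BoundedContinuousFunction ℕ ℝ, ‖g‖ ≤ 1 → ∃ a : X, ‖a‖ ≤ 1 ∧ q a = g) :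
    ¬ HasC0ExtensionProperty X := by
  classical
  intro hX
  obtain ⟨S, hS⟩ := hX (nullPreimage q) (isClosed_nullPreimage q) (nullRestrict q)
  have hS' : ∀ a : X, (q a : ℕ → ℝ).support.Finite → ∀ n, S a n = q a n := by
    intro a ha n
    have hmem : a ∈ nullPreimage q := by
      change Tendsto (q a) (cocompact ℕ) (𝓝 0)
      rw [cocompact_eq_cofinite]
      refine tendsto_const_nhds.congr' ?_
      filter_upwards [ha.compl_mem_cofinite] with n hn
      exact (Function.notMem_support.1 hn).symm
    exact congrArg (fun g : C₀(ℕ, ℝ) => g n) (hS ⟨a, hmem⟩)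
  let ind : (ℕ → Bool) → BoundedContinuousFunction ℕ ℝ := fun x =>
    BoundedContinuousFunction.ofNormedAddCommGroupDiscrete ((branch x).indicator 1) 1 fun n => by
      by_cases h : n ∈ branch x <;> simp [h]
  have hind : ∀ x n, ind x n = (branch x).indicator 1 n := fun _ _ => rfl
  have hind1 : ∀ x, ‖ind x‖ ≤ 1 := fun x =>
    BoundedContinuousFunction.norm_ofNormedAddCommGroup_le _ zero_le_one _
  choose e he1 heq using fun x => hq (ind x) (hind1 x)
  -- The defect `d x` is not identically zero: `S (e x)` tends to zero, while `ind x` equals 1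
  -- infinitely often.
  let d : (ℕ → Bool) → ℕ → ℝ := fun x n => S (e x) n - ind x n
  have hd : ∀ x, ∃ p : ℕ × ℕ, 1 / ((p.2 : ℝ) + 1) < |d x p.1| := by
    intro x
    have : ∃ n, d x n ≠ 0 := by
      by_contra! h
      have hlim : Tendsto (fun n => S (e x) n) (cocompact ℕ) (𝓝 0) := (S (e x)).zero_at_infty'
      rw [cocompact_eq_cofinite] at hlim
      have hev := hlim.eventually_lt_const (zero_lt_one)
      refine branch_infinite x (Set.Finite.subset hev fun n hn => ?_)
      have h1 : S (e x) n = 1 := by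
        have := sub_eq_zero.1 (h n)
        rw [this, hind, Set.indicator_of_mem hn, Pi.one_apply]
      simp [h1]
    obtain ⟨n, hn⟩ := this
    obtain ⟨k, hk⟩ := exists_nat_one_div_lt (abs_pos.2 hn)
    exact ⟨(n, k), hk⟩
  choose p hp using hd
  -- Pigeonhole: uncountably many branches, countably many pairs.
  obtain ⟨⟨n, k⟩, hinf⟩ : ∃ c, (p ⁻¹' {c}).Infinite := by
    by_contra! h
    have : (Set.univ : Set (ℕ → Bool)).Countable := by
      rw [← Set.preimage_univ (f := p), ← Set.iUnion_of_singleton, Set.preimage_iUnion]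
      exact Set.countable_iUnion fun c => (h c).countable
    have hunc : Uncountable (ℕ → Bool) := by
      rw [← Cardinal.aleph0_lt_mk_iff]
      simpa using Cardinal.cantor ℵ₀
    exact not_countable (α := ℕ → Bool) (Set.countable_univ_iff.1 this)
  obtain ⟨m, hm⟩ := exists_nat_gt ((‖S‖ + 1) * ((k : ℝ) + 1))
  obtain ⟨F, hF, hcard⟩ := hinf.exists_subset_card_eq m
  let s : (ℕ → Bool) → ℝ := fun x => SignType.sign (d x n)
  -- The signs make the defects at `n` add up, while almost disjointness keeps `q v` bounded by 1
  -- off the finite set `B`.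
  let v : X := ∑ x ∈ F, s x • e x
  have hqv : ∀ j, q v j = ∑ x ∈ F, s x * (branch x).indicator 1 j := by
    intro j
    simp [v, heq, hind]
  let B : Set ℕ := ⋃ x ∈ F, ⋃ y ∈ F, ⋃ _ : x ≠ y, branch x ∩ branch y
  have hB : B.Finite := F.finite_toSet.biUnion fun x _ => F.finite_toSet.biUnion fun y _ =>
    Set.finite_iUnion fun h => branch_inter_finite h
  have hs : ∀ x, |s x| ≤ 1 := fun x => by
    rcases lt_trichotomy (d x n) 0 with h | h | h <;> simp [s, h]
  have hbound : ∀ j, ‖Bᶜ.indicator (q v) j‖ ≤ 1 := by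
    intro j
    by_cases hj : j ∈ B
    · simp [hj]
    rw [Set.indicator_of_mem hj, hqv]
    by_cases hex : ∃ x ∈ F, j ∈ branch x
    · obtain ⟨x, hx, hjx⟩ := hex
      rw [Finset.sum_eq_single_of_mem x hx]
      · simpa [hjx] using hs x
      · intro y hy hyx
        rw [Set.indicator_of_notMem, mul_zero]
        intro hjy
        exact hj (by simp only [B, Set.mem_iUnion]; exact ⟨y, hy, x, hx, hyx, hjy, hjx⟩)
    · push Not at hex
      rw [Finset.sum_eq_zero]
      · simp
      · intro x hx
        rw [Set.indicator_of_notMem (hex x hx), mul_zero]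
  let z : BoundedContinuousFunction ℕ ℝ :=
    BoundedContinuousFunction.ofNormedAddCommGroupDiscrete _ 1 hbound
  have hz : ∀ j, z j = Bᶜ.indicator (q v) j := fun _ => rfl
  have hz1 : ‖z‖ ≤ 1 := BoundedContinuousFunction.norm_ofNormedAddCommGroup_le _ zero_le_one _
  -- Replacing `v` by a lift `a` of the truncation changes `q v` only on `B`, so the total defect is
  -- unchanged, yet `a` is in the unit ball.
  obtain ⟨a, ha1, haz⟩ := hq z hz1
  have hkey := hS' (v - a) (hB.subset fun j hj => by
    by_contra hjB
    refine hj ?_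
    simp [haz, hz, hjB]) n
  have hsum : ∑ x ∈ F, |d x n| = S a n - z n := by
    have h1 : S v n = ∑ x ∈ F, s x * S (e x) n := by
      simp only [v, map_sum, map_smul]
      have := map_sum (⟨⟨fun g => g n, rfl⟩, fun _ _ => rfl⟩ : C₀(ℕ, ℝ) →+ ℝ)
        (fun x => s x • S (e x)) F
      exact this
    have h2 : q v n = ∑ x ∈ F, s x * ind x n := hqv n
    have h3 : ∑ x ∈ F, |d x n| = S v n - q v n := by
      rw [h1, h2, ← Finset.sum_sub_distrib]
      refine Finset.sum_congr rfl fun x _ => ?_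
      rw [← mul_sub]
      exact (sign_mul_self (d x n)).symm
    rw [h3]
    simp only [map_sub, haz, ZeroAtInftyContinuousMap.sub_apply,
      BoundedContinuousFunction.sub_apply] at hkey
    linarith
  have hupper : S a n - z n ≤ ‖S‖ + 1 := by
    have h1 : |S a n| ≤ ‖S‖ := by
      calc |S a n| = ‖(S a).toBCF n‖ := rfl
        _ ≤ ‖(S a).toBCF‖ := (S a).toBCF.norm_coe_le_norm n
        _ = ‖S a‖ := ZeroAtInftyContinuousMap.norm_toBCF_eq_norm
        _ ≤ ‖S‖ := S.unit_le_opNorm a ha1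
    have h2 : |z n| ≤ 1 := hbound n
    linarith [(abs_le.1 h1).2, (abs_le.1 h2).1]
  have hlower : (m : ℝ) * (1 / ((k : ℝ) + 1)) ≤ ∑ x ∈ F, |d x n| := by
    rw [← hcard, ← nsmul_eq_mul]
    refine Finset.card_nsmul_le_sum F _ _ fun x hx => ?_
    have hpx : p x = (n, k) := hF hx
    have := hp x
    rw [hpx] at this
    exact this.le
  have hk : (0 : ℝ) < (k : ℝ) + 1 := by positivity
  rw [mul_one_div, hsum, div_le_iff₀ hk] at hlower
  nlinarith

/-- The unit ball of `ℓ∞` has at most `𝔠` elements, so the unit vectors can be sent onto all of it.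
-/
theorem not_hasC0ExtensionProperty_ellOne {Γ : Type} (hΓ : 𝔠 ≤ #Γ) :
    ¬ HasC0ExtensionProperty (lp (fun _ : Γ => ℝ) 1) := by
  classical
  let J : Type := {g : BoundedContinuousFunction ℕ ℝ // ‖g‖ ≤ 1}
  have hJ : #J ≤ 𝔠 := by
    have : #J ≤ #(ℕ → ℝ) := Cardinal.mk_le_of_injective
      (f := fun g : J => (g.1 : ℕ → ℝ)) fun g h hgh => Subtype.ext (DFunLike.coe_injective hgh)
    simpa [Cardinal.mk_real] using this
  obtain ⟨i⟩ := hJ.trans hΓ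
  have : Nonempty J := ⟨⟨0, by simp⟩⟩
  let f : Γ → J := Function.invFun i
  refine not_hasC0ExtensionProperty_of_lift (ellOneLift (fun γ => (f γ).1) fun γ => (f γ).2)
    fun g hg => ⟨lp.single 1 (i ⟨g, hg⟩) 1, ?_, ?_⟩
  · rw [lp.norm_single (by simp)]
    simp
  · rw [ellOneLift_single]
    simp only [f]
    rw [Function.leftInverse_invFun i.injective]

end NoExtension

/-! ### The compact space of a family of closed sets -/

section FiberFamily

variable {Γ T : Type*}

/-- The sets of indices `A` for which the sets `E γ`, `γ ∈ A`, have a common point. -/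
def fiberFamily (E : Γ → Set T) : Set (Set Γ) :=
  {A | ∃ t, ∀ γ ∈ A, t ∈ E γ}

theorem isAdequateFamily_fiberFamily [TopologicalSpace T] [CompactSpace T] {E : Γ → Set T}
    (hE : ∀ γ, IsClosed (E γ)) : IsAdequateFamily (fiberFamily E) := by
  classical
  refine ⟨fun A ⟨t, ht⟩ B hBA => ⟨t, fun γ hγ => ht γ (hBA hγ)⟩, fun A hA => ?_⟩
  -- Finite intersection property in `T`.
  have hne := isCompact_univ.inter_iInter_nonempty (fun γ : A => E γ) (fun γ => hE γ) fun u => by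
    obtain ⟨t, ht⟩ := hA (u.map (Function.Embedding.subtype _) : Finset Γ)
      (by intro x; simp +contextual) (Finset.finite_toSet _)
    refine ⟨t, trivial, Set.mem_iInter₂.2 fun γ hγ => ht γ ?_⟩
    simpa using hγ
  obtain ⟨t, -, ht⟩ := hne
  exact ⟨t, fun γ hγ => Set.mem_iInter.1 ht ⟨γ, hγ⟩⟩

theorem mem_adequateSpace_fiberFamily {E : Γ → Set T} {x : Γ → ℝ} :
    x ∈ adequateSpace (fiberFamily E) ↔ ∃ t, ∀ γ, x γ = 0 ∨ (x γ = 1 ∧ t ∈ E γ) := by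
  classical
  constructor
  · rintro ⟨A, ⟨t, ht⟩, rfl⟩
    refine ⟨t, fun γ => ?_⟩
    by_cases h : γ ∈ A
    · exact .inr ⟨by simp [h], ht γ h⟩
    · exact .inl (by simp [h])
  · rintro ⟨t, ht⟩
    refine ⟨{γ | x γ = 1}, ⟨t, fun γ hγ => ?_⟩, ?_⟩
    · rcases ht γ with h | h
      · have h1 : x γ = 1 := hγ
        simp [h] at h1
      · exact h.2
    · ext γ
      rcases ht γ with h | h
      · simp [h]
      · simp [h.1]

theorem isCompact_adequateSpace_fiberFamily [TopologicalSpace T] [CompactSpace T]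
    {E : Γ → Set T} (hE : ∀ γ, IsClosed (E γ)) :
    IsCompact (adequateSpace (fiberFamily E)) := by
  -- Keeping the witness `t` as an extra coordinate makes the condition closed; projecting then
  -- forgets it.
  let C : Set (T × (Γ → ℝ)) := {p | ∀ γ, p.2 γ = 0 ∨ (p.2 γ = 1 ∧ p.1 ∈ E γ)}
  have hC : IsClosed C := by
    have : C = ⋂ γ, ({p : T × (Γ → ℝ) | p.2 γ = 0} ∪ ({p | p.2 γ = 1} ∩ Prod.fst ⁻¹' E γ)) := by
      ext p
      simp [C]
    rw [this]
    refine isClosed_iInter fun γ => .union (isClosed_eq (by fun_prop) (by fun_prop))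
      (.inter (isClosed_eq (by fun_prop) (by fun_prop)) ((hE γ).preimage continuous_fst))
  have hcpt : IsCompact (Set.univ ×ˢ Set.univ.pi fun _ => Set.Icc 0 1 : Set (T × (Γ → ℝ))) :=
    isCompact_univ.prod (isCompact_univ_pi fun _ => isCompact_Icc)
  have hsub : C ⊆ Set.univ ×ˢ Set.univ.pi fun _ => Set.Icc 0 1 := fun p hp =>
    ⟨trivial, fun γ _ => by rcases hp γ with h | h <;> simp [h]⟩
  have himg : adequateSpace (fiberFamily E) = Prod.snd '' C := by
    ext x
    rw [mem_adequateSpace_fiberFamily]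
    constructor
    · rintro ⟨t, ht⟩
      exact ⟨(t, x), ht, rfl⟩
    · rintro ⟨⟨t, y⟩, ht, rfl⟩
      exact ⟨t, ht⟩
  rw [himg]
  exact (hcpt.of_isClosed_subset hC hsub).image continuous_snd

/-- The coordinate functions on `adequateSpace`. -/
def adequateCoord (𝒜 : Set (Set Γ)) (γ : Γ) : C(adequateSpace 𝒜, ℝ) :=
  ⟨fun x => x.1 γ, (continuous_apply γ).comp continuous_subtype_val⟩

theorem adequateCoord_norm_le (𝒜 : Set (Set Γ)) [CompactSpace (adequateSpace 𝒜)] (γ : Γ) :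
    ‖adequateCoord 𝒜 γ‖ ≤ 1 := by
  refine (ContinuousMap.norm_le _ zero_le_one).2 ?_
  rintro ⟨_, A, -, rfl⟩
  by_cases h : γ ∈ A <;> simp [adequateCoord, h]

/-- The point of `adequateSpace (fiberFamily E)` given by the indices in `B` of sets through `t`. -/
noncomputable def fiberPoint (E : Γ → Set T) (B : Set Γ) (t : T) :
    adequateSpace (fiberFamily E) :=
  ⟨({γ | t ∈ E γ} ∩ B).indicator 1, _, ⟨t, fun _ h => h.1⟩, rfl⟩

theorem adequateCoord_fiberPoint (E : Γ → Set T) (B : Set Γ) (t : T) (γ : Γ) :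
    adequateCoord (fiberFamily E) γ (fiberPoint E B t) = ({γ | t ∈ E γ} ∩ B).indicator 1 γ := rfl

theorem adequateCoord_fiberPoint_univ (E : Γ → Set T) (t : T) (γ : Γ) :
    adequateCoord (fiberFamily E) γ (fiberPoint E Set.univ t) = (E γ).indicator 1 t := by
  rw [adequateCoord_fiberPoint, Set.inter_univ]
  by_cases h : t ∈ E γ <;> simp [h]

theorem isCorsonCompactum_adequateSpace {Γ : Type} {𝒜 : Set (Set Γ)}
    (hK : IsCompact (adequateSpace 𝒜)) (h𝒜 : ∀ A ∈ 𝒜, A.Countable) :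
    IsCorsonCompactum (adequateSpace 𝒜) := by
  refine ⟨isCompact_iff_compactSpace.1 hK, Γ, Subtype.val ⁻¹' adequateSpace 𝒜,
    hK.isClosed.preimage continuous_subtype_val, ⟨?_⟩⟩
  have hsub : adequateSpace 𝒜 ⊆ SigmaProduct Γ := by
    rintro _ ⟨A, hA, rfl⟩
    exact (h𝒜 A hA).mono Set.support_indicator_subset
  exact
    { toFun := fun x => ⟨⟨x.1, hsub x.2⟩, x.2⟩
      invFun := fun x => ⟨x.1.1, x.2⟩
      left_inv := fun _ => rfl
      right_inv := fun _ => rfl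
      continuous_toFun := by fun_prop
      continuous_invFun := by fun_prop }

/-- The operator sending the unit vectors of `ℓ₁(Γ)` to the coordinate functions. -/
noncomputable def coordOperator (𝒜 : Set (Set Γ)) [CompactSpace (adequateSpace 𝒜)] :
    lp (fun _ : Γ => ℝ) 1 →L[ℝ] C(adequateSpace 𝒜, ℝ) :=
  ellOneLift (adequateCoord 𝒜) (adequateCoord_norm_le 𝒜)

/-- Heredity of the family allows all indices outside `F` to be switched off at a point of the
space. -/
theorem coordOperator_fiberPoint {E : Γ → Set T} [CompactSpace (adequateSpace (fiberFamily E))]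
    (a : lp (fun _ : Γ => ℝ) 1) (F : Finset Γ) (t : T) :
    coordOperator (fiberFamily E) a (fiberPoint E F t) =
      ∑ γ ∈ F, a γ * (E γ).indicator 1 t := by
  have hs := ((lp_one_summable_norm_smul a
    (adequateCoord_norm_le (fiberFamily E))).of_norm).hasSum
  have h := hs.map (ContinuousMap.evalCLM ℝ (fiberPoint E F t))
    (ContinuousMap.evalCLM ℝ (fiberPoint E F t)).continuous
  refine h.unique ?_
  have hF : ∑ γ ∈ F, a γ * (E γ).indicator 1 t =
      ∑ γ ∈ F, a γ * ({γ | t ∈ E γ} ∩ F).indicator 1 γ := by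
    refine Finset.sum_congr rfl fun γ hγ => ?_
    by_cases ht : t ∈ E γ <;> simp [hγ, ht]
  rw [hF]
  refine hasSum_sum_of_ne_finset_zero fun γ hγ => ?_
  simp [adequateCoord_fiberPoint, hγ]

/-! ### Integral estimates and the induced measure -/

variable [MeasurableSpace T] (P : Measure T) [IsProbabilityMeasure P]

/-- Some value of the sum is at least its mean. -/
theorem exists_sum_fiber_ge {E : Γ → Set T} (hE : ∀ γ, MeasurableSet (E γ)) {ε : ℝ}
    (hPE : ∀ γ, ε ≤ P.real (E γ)) (F : Finset Γ) {c : Γ → ℝ} (hc : ∀ γ ∈ F, 0 ≤ c γ) :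
    ∃ t, ε * ∑ γ ∈ F, c γ ≤ ∑ γ ∈ F, c γ * (E γ).indicator 1 t := by
  have hint : ∀ γ, Integrable (fun t => c γ * (E γ).indicator (1 : T → ℝ) t) P := fun γ =>
    ((integrable_const (1 : ℝ)).indicator (hE γ)).const_mul _
  obtain ⟨t, ht⟩ := exists_integral_le (μ := P)
    (f := fun t => ∑ γ ∈ F, c γ * (E γ).indicator 1 t) (integrable_finsetSum _ fun γ _ => hint γ)
  refine ⟨t, le_trans ?_ ht⟩
  rw [integral_finsetSum _ fun γ _ => hint γ, Finset.mul_sum]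
  refine Finset.sum_le_sum fun γ hγ => ?_
  rw [integral_const_mul, integral_indicator_one (hE γ), mul_comm]
  exact mul_le_mul_of_nonneg_left (hPE γ) (hc γ hγ)

/-- The positive and the negative coefficients are tested separately, each costing a factor `1 / ε`.
-/
theorem sum_abs_le_norm_coordOperator {E : Γ → Set T}
    [CompactSpace (adequateSpace (fiberFamily E))] (hE : ∀ γ, MeasurableSet (E γ)) {ε : ℝ}
    (hε : 0 < ε) (hPE : ∀ γ, ε ≤ P.real (E γ)) (a : lp (fun _ : Γ => ℝ) 1) (F : Finset Γ) :
    ∑ γ ∈ F, |a γ| ≤ 2 / ε * ‖coordOperator (fiberFamily E) a‖ := by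
  have key : ∀ b : lp (fun _ : Γ => ℝ) 1, ∀ G : Finset Γ, (∀ γ ∈ G, 0 ≤ b γ) →
      ε * ∑ γ ∈ G, b γ ≤ ‖coordOperator (fiberFamily E) b‖ := by
    intro b G hb
    obtain ⟨t, ht⟩ := exists_sum_fiber_ge P hE hPE G hb
    rw [← coordOperator_fiberPoint] at ht
    exact ht.trans ((le_abs_self _).trans ((coordOperator (fiberFamily E) b).norm_coe_le_norm _))
  have h1 := key a (F.filter fun γ => 0 ≤ a γ) fun γ hγ => (Finset.mem_filter.1 hγ).2
  have h2 := key (-a) (F.filter fun γ => ¬ 0 ≤ a γ) fun γ hγ => by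
    have := (Finset.mem_filter.1 hγ).2
    simp only [lp.coeFn_neg, Pi.neg_apply]
    linarith
  rw [map_neg, norm_neg] at h2
  have hsplit : ∑ γ ∈ F, |a γ| = ∑ γ ∈ F with 0 ≤ a γ, a γ +
      ∑ γ ∈ F with ¬ 0 ≤ a γ, (-a) γ := by
    rw [← Finset.sum_filter_add_sum_filter_not F fun γ => 0 ≤ a γ]
    congr 1
    · exact Finset.sum_congr rfl fun γ hγ => abs_of_nonneg (Finset.mem_filter.1 hγ).2
    · exact Finset.sum_congr rfl fun γ hγ =>
        abs_of_neg (not_le.1 (Finset.mem_filter.1 hγ).2)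
  rw [hsplit, div_mul_eq_mul_div, le_div_iff₀ hε]
  linarith

theorem containsIsomorphicCopy_ellOne {E : Γ → Set T}
    [CompactSpace (adequateSpace (fiberFamily E))] (hE : ∀ γ, MeasurableSet (E γ)) {ε : ℝ}
    (hε : 0 < ε) (hPE : ∀ γ, ε ≤ P.real (E γ)) :
    ContainsIsomorphicCopy C(adequateSpace (fiberFamily E), ℝ) (lp (fun _ : Γ => ℝ) 1) := by
  refine ContainsIsomorphicCopy.of_bounded_below (i := coordOperator (fiberFamily E))
    (C := 2 / ε) fun a => ?_
  refine lp.norm_le_of_forall_sum_le (by simp) (by positivity) fun F => ?_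
  simpa using sum_abs_le_norm_coordOperator P hE hε hPE a F

/-- Stone–Weierstrass: the functions with this property form a subalgebra closed under limits of
sequences, and it contains the coordinates. Borel measurability of the point map itself is not
needed. -/
theorem measurable_comp_fiberPoint {E : Γ → Set T}
    [CompactSpace (adequateSpace (fiberFamily E))] (hE : ∀ γ, MeasurableSet (E γ))
    (f : C(adequateSpace (fiberFamily E), ℝ)) :
    Measurable fun t => f (fiberPoint E Set.univ t) := by
  let S : Subalgebra ℝ C(adequateSpace (fiberFamily E), ℝ) :=
    { carrier := {f | Measurable fun t => f (fiberPoint E Set.univ t)}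
      mul_mem' := fun hf hg => Measurable.mul hf hg
      add_mem' := fun hf hg => Measurable.add hf hg
      algebraMap_mem' := fun r => measurable_const }
  have hcoord : ∀ γ, adequateCoord (fiberFamily E) γ ∈ S := fun γ => by
    change Measurable _
    simp_rw [adequateCoord_fiberPoint_univ]
    exact measurable_one.indicator (hE γ)
  have hsep : S.SeparatesPoints := by
    intro x y hxy
    obtain ⟨γ, hγ⟩ := Function.ne_iff.1 (Subtype.coe_ne_coe.2 hxy)
    exact ⟨_, ⟨_, hcoord γ, rfl⟩, hγ⟩
  have htop := ContinuousMap.subalgebra_topologicalClosure_eq_top_of_separatesPoints S hsep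
  have hf : f ∈ closure (S : Set C(adequateSpace (fiberFamily E), ℝ)) := by
    rw [← Subalgebra.topologicalClosure_coe, htop]
    trivial
  obtain ⟨u, hu, hlim⟩ := mem_closure_iff_seq_limit.1 hf
  refine measurable_of_tendsto_metrizable (f := fun n t => u n (fiberPoint E Set.univ t))
    (fun n => hu n) (tendsto_pi_nhds.2 fun t => ?_)
  exact ((ContinuousMap.evalCLM ℝ (fiberPoint E Set.univ t)).continuous.tendsto f).comp hlim

theorem integrable_comp_fiberPoint {E : Γ → Set T}
    [CompactSpace (adequateSpace (fiberFamily E))] (hE : ∀ γ, MeasurableSet (E γ))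
    (f : C(adequateSpace (fiberFamily E), ℝ)) :
    Integrable (fun t => f (fiberPoint E Set.univ t)) P :=
  .of_bound (measurable_comp_fiberPoint hE f).aestronglyMeasurable ‖f‖
    (ae_of_all _ fun _ => f.norm_coe_le_norm _)

/-- The Riesz theorem supplies a substitute for the pushforward of `P`, with regularity included. -/
theorem exists_regular_measure_fiberFamily {E : Γ → Set T}
    [CompactSpace (adequateSpace (fiberFamily E))] (hE : ∀ γ, MeasurableSet (E γ))
    [MeasurableSpace (adequateSpace (fiberFamily E))]
    [BorelSpace (adequateSpace (fiberFamily E))] :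
    ∃ μ : Measure (adequateSpace (fiberFamily E)), μ.Regular ∧ IsFiniteMeasure μ ∧
      ∀ f : C(adequateSpace (fiberFamily E), ℝ),
        ∫ x, f x ∂μ = ∫ t, f (fiberPoint E Set.univ t) ∂P := by
  let Λ : CompactlySupportedContinuousMap (adequateSpace (fiberFamily E)) ℝ →ₚ[ℝ] ℝ :=
    { toFun := fun f => ∫ t, f (fiberPoint E Set.univ t) ∂P
      map_add' := fun f g => integral_add (integrable_comp_fiberPoint P hE f.toContinuousMap)
        (integrable_comp_fiberPoint P hE g.toContinuousMap)
      map_smul' := fun c f => integral_const_mul c _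
      monotone' := fun f g hfg => integral_mono
        (integrable_comp_fiberPoint P hE f.toContinuousMap)
        (integrable_comp_fiberPoint P hE g.toContinuousMap) fun t => hfg _ }
  refine ⟨RealRMK.rieszMeasure Λ, inferInstance, inferInstance, fun f => ?_⟩
  exact RealRMK.integral_rieszMeasure Λ ⟨f, HasCompactSupport.of_compactSpace _⟩

theorem not_hasPropertyM_fiberFamily [Uncountable Γ] {E : Γ → Set T}
    [CompactSpace (adequateSpace (fiberFamily E))] (hE : ∀ γ, MeasurableSet (E γ))
    (hcount : ∀ t, {γ | t ∈ E γ}.Countable) (hPE : ∀ γ, 0 < P.real (E γ)) :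
    ¬ HasPropertyM (adequateSpace (fiberFamily E)) := by
  let _ : MeasurableSpace (adequateSpace (fiberFamily E)) := borel _
  have : BorelSpace (adequateSpace (fiberFamily E)) := ⟨rfl⟩
  intro hM
  obtain ⟨μ, hreg, hfin, hμ⟩ := exists_regular_measure_fiberFamily P hE
  have htv : μ.toSignedMeasure.totalVariation = μ := by
    rw [SignedMeasure.totalVariation_eq_variation, Measure.variation_toSignedMeasure]
  have hsep := hM μ.toSignedMeasure (by rw [htv]; exact hreg)
  rw [htv] at hsep
  obtain ⟨D, hD, hdense⟩ := hsep.exists_countable_dense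
  have hsupp : ∀ x : adequateSpace (fiberFamily E), (Function.support x.1).Countable := by
    rintro ⟨_, A, ⟨t, ht⟩, rfl⟩
    exact (hcount t).mono (Set.support_indicator_subset.trans ht)
  -- A coordinate vanishing on all of `D`; its integral is nevertheless `P.real (E γ) > 0`, so it
  -- cannot vanish on the support.
  obtain ⟨γ, hγ⟩ : ∃ γ, γ ∉ ⋃ x ∈ D, Function.support x.1.1 := by
    by_contra! h
    have := hD.biUnion fun x _ => hsupp x.1
    rw [Set.eq_univ_of_forall h] at this
    exact not_countable (Set.countable_univ_iff.1 this)
  let U : Set (adequateSpace (fiberFamily E)) := {x | adequateCoord (fiberFamily E) γ x ≠ 0}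
  have hU : IsOpen U := isOpen_ne_fun (map_continuous _) continuous_const
  have hUpos : 0 < μ U := by
    by_contra! h
    have hzero : ∫ x, adequateCoord (fiberFamily E) γ x ∂μ = 0 := by
      refine integral_eq_zero_of_ae ?_
      rw [Filter.EventuallyEq, ae_iff]
      exact le_antisymm h bot_le
    rw [hμ] at hzero
    simp_rw [adequateCoord_fiberPoint_univ] at hzero
    rw [integral_indicator_one (hE γ)] at hzero
    exact (hPE γ).ne' hzero
  have hne : (U ∩ μ.support).Nonempty := by
    by_contra h
    rw [Set.not_nonempty_iff_eq_empty, ← Set.disjoint_iff_inter_eq_empty] at h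
    have := measure_mono_null h.subset_compl_right
      (Measure.measure_compl_support_of_regular (μ := μ))
    exact hUpos.ne' this
  obtain ⟨x, hxU, hx⟩ := hne
  obtain ⟨y, hyU, hyD⟩ := hdense.inter_open_nonempty (Subtype.val ⁻¹' U)
    (hU.preimage continuous_subtype_val) ⟨⟨x, hx⟩, hxU⟩
  exact hγ (Set.mem_biUnion hyD hyU)

end FiberFamily

/-! ### The closed sets obtained from CH, and the conclusion -/

theorem countable_Iio_toType_omega_one (γ : (ω₁ : Ordinal.{0}).ToType) :
    (Set.Iio γ).Countable := by
  have h := Cardinal.mk_Iio_lt γ (by simp)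
  rw [← Cardinal.le_aleph0_iff_set_countable, ← Order.lt_succ_iff, ← Cardinal.aleph_zero,
    Cardinal.succ_aleph]
  simpa using h

theorem exists_closed_point_countable (CH : (ℵ₁ : Cardinal.{0}) = 𝔠) :
    ∃ E : (ω₁ : Ordinal.{0}).ToType → Set unitInterval, (∀ γ, IsClosed (E γ)) ∧
      (∀ t, {γ | t ∈ E γ}.Countable) ∧ ∀ γ, 1 / 2 ≤ volume.real (E γ) := by
  have hcard : #unitInterval = #((ω₁ : Ordinal.{0}).ToType) := by
    rw [Cardinal.mk_toType, Ordinal.card_omega, CH]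
    exact Cardinal.mk_Icc_real zero_lt_one
  obtain ⟨e⟩ := Cardinal.eq.1 hcard
  -- Inner regularity: the complement of a countable set has full measure, so any bound below 1
  -- would do.
  have hex : ∀ γ, ∃ C ⊆ (e.symm '' Set.Iio γ)ᶜ, IsCompact C ∧
      (1 / 2 : ENNReal) < volume C := fun γ => by
    have hc : (e.symm '' Set.Iio γ).Countable := (countable_Iio_toType_omega_one γ).image _
    refine hc.measurableSet.compl.exists_lt_isCompact ?_
    rw [prob_compl_eq_one_sub hc.measurableSet, hc.measure_zero]
    simp
  choose E hsub hcpt hvol using hex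
  refine ⟨E, fun γ => (hcpt γ).isClosed, fun t => ?_, fun γ => ?_⟩
  -- `E γ` misses `t` once `e t < γ`, which leaves only the indices up to `e t`.
  · refine ((countable_Iio_toType_omega_one (e t)).insert (e t)).mono fun γ hγ => ?_
    by_contra hlt
    simp only [Set.mem_insert_iff, Set.mem_Iio, not_or, not_lt] at hlt
    exact hsub γ hγ ⟨e t, lt_of_le_of_ne hlt.2 (Ne.symm hlt.1), e.symm_apply_apply t⟩
  · have := ENNReal.toReal_mono (measure_ne_top _ _) (hvol γ).le
    simpa [Measure.real] using this

theorem proposition3p4 (CH : (ℵ₁ : Cardinal.{0}) = 𝔠) :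
    ∃ (K : Type) (_ : TopologicalSpace K) (_ : CompactSpace K) (_ : T2Space K),
      IsCorsonCompactum K ∧
      IsDefinedByAdequateFamily K ∧
      ¬ HasPropertyM K ∧
      ContainsIsomorphicCopy C(K, ℝ) EllOneOmegaOne ∧
      ¬ HasC0ExtensionProperty C(K, ℝ) := by
  obtain ⟨E, hE, hcount, hvol⟩ := exists_closed_point_countable CH
  have hK := isCompact_adequateSpace_fiberFamily hE
  have hKc : CompactSpace (adequateSpace (fiberFamily E)) := isCompact_iff_compactSpace.1 hK
  have hmeas : ∀ γ, MeasurableSet (E γ) := fun γ => (hE γ).measurableSet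
  have hcard : #((ω₁ : Ordinal.{0}).ToType) = 𝔠 := by
    rw [Cardinal.mk_toType, Ordinal.card_omega, CH]
  have : Uncountable (ω₁ : Ordinal.{0}).ToType := by
    rw [← Cardinal.aleph0_lt_mk_iff, hcard]
    exact Cardinal.aleph0_lt_continuum
  have hcopy : ContainsIsomorphicCopy C(adequateSpace (fiberFamily E), ℝ) EllOneOmegaOne :=
    containsIsomorphicCopy_ellOne volume hmeas one_half_pos hvol
  refine ⟨adequateSpace (fiberFamily E), inferInstance, hKc, inferInstance,
    isCorsonCompactum_adequateSpace hK ?_,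
    ⟨_, _, isAdequateFamily_fiberFamily hE, ⟨Homeomorph.refl _⟩⟩,
    not_hasPropertyM_fiberFamily volume hmeas hcount fun γ => one_half_pos.trans_le (hvol γ),
    hcopy, fun h => not_hasC0ExtensionProperty_ellOne hcard.ge (h.of_containsIsomorphicCopy hcopy)⟩
  rintro A ⟨t, ht⟩
  exact (hcount t).mono ht
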